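/- Let $\mathcal A$ be a finite alphabet and let $\mathbf w = x_1x_2x_3\cdots$ be an infinite word over $\mathcal A$. A finite word $u$ is a factor of $\mathbf w$ if it occurs in $\mathbf w$ as a block of consecutive letters (the empty word is a factor), and it is a palindrome if it equals its reversal. The word $\mathbf w$ is recurrent if each of its factors occurs infinitely often in it. A complete return to a factor $u$ in $\mathbf w$ is a factor $r$ of $\mathbf w$ that contains exactly two occurrences of $u$, one as a prefix and one as a suffix; $\mathbf w$ is rich if every complete return to every palindromic factor of $\mathbf w$ is a palindrome. For $n\ge 0$ let $\mathcal C(n)$ and $\mathcal P(n)$ be the numbers of distinct factors, respectively distinct palindromic factors, of $\mathbf w$ of length $n$. Suppose that $\mathbf w$ is a recurrent rich infinite word. Then: (i) $\mathbf w$ is purely periodic (that is, $\mathbf w = vvv\cdots$ for some non-empty finite word $v$) if and only if $\mathcal P(n)+\mathcal P(n+1)=2$ for some integer $n\ge 0$. (ii) The sequence $(\mathcal P(n))_{n\ge 1}$ is eventually periodic with period $2$ (that is, $\mathcal P(n+2)=\mathcal P(n)$ for all sufficiently large $n$; $2$ need not be the least period) if and only if there exist integers $K\ge 0$, $L$ and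 $N\ge 0$ such that $\mathcal C(n)=Kn+L$ for all $n\ge N$. -/

import Mathlib

/-! Infinite words over an alphabet `A` are sequences `w : ℕ → A` (indexed from `0`);
finite words are lists. -/

namespace InfWord

variable {A : Type*}

/-- The block of length `n` of the infinite word `w` that starts at position `i`. -/
def block (w : ℕ → A) (i n : ℕ) : List A :=
  List.ofFn fun j : Fin n => w (i + j)

/-- The finite word `u` occurs in the infinite word `w` at position `i`. -/
def OccursIn (w : ℕ → A) (u : List A) (i : ℕ) : Prop :=
  block w i u.length = u

/-- `u` is a factor of the infinite word `w`. -/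
def IsFactor (w : ℕ → A) (u : List A) : Prop :=
  ∃ i, OccursIn w u i

/-- `w` is recurrent: each of its factors occurs infinitely often in it. -/
def Recurrent (w : ℕ → A) : Prop :=
  ∀ u, IsFactor w u → {i | OccursIn w u i}.Infinite

/-- A finite word that equals its reversal. -/
def IsPalindrome (u : List A) : Prop :=
  u.reverse = u

/-- The finite word `u` occurs in the finite word `r` at position `i`. -/
def OccursInFinite (r u : List A) (i : ℕ) : Prop :=
  ∃ s t : List A, r = s ++ u ++ t ∧ s.length = i

/-- `r` is a complete return to `u` in `w`: a factor of `w` that contains exactly two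
occurrences of `u`, one as a prefix and one as a suffix. -/
def IsCompleteReturn (w : ℕ → A) (u r : List A) : Prop :=
  IsFactor w r ∧ u <+: r ∧ u <:+ r ∧ {i | OccursInFinite r u i}.ncard = 2

/-- `w` is rich: all complete returns to any palindromic factor of `w` are palindromes. -/
def Rich (w : ℕ → A) : Prop :=
  ∀ u, IsFactor w u → IsPalindrome u → ∀ r, IsCompleteReturn w u r → IsPalindrome r

/-- Factor complexity: the number of distinct factors of `w` of length `n`. -/
noncomputable def factorComplexity (w : ℕ → A) (n : ℕ) : ℕ :=
  {u : List A | IsFactor w u ∧ u.length = n}.ncard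

/-- Palindromic complexity: the number of distinct palindromic factors of `w` of length `n`. -/
noncomputable def palComplexity (w : ℕ → A) (n : ℕ) : ℕ :=
  {u : List A | IsFactor w u ∧ IsPalindrome u ∧ u.length = n}.ncard

/-- `w` is purely periodic: it is `v v v ⋯` for some nonempty finite word `v`. -/
def PurelyPeriodic (w : ℕ → A) : Prop :=
  ∃ p, 0 < p ∧ Function.Periodic w p

/-- From some index on, the sequence `f` is periodic with period `p` (not necessarily its least
period). -/
def EventuallyPeriodicWith (f : ℕ → ℕ) (p : ℕ) : Prop :=
  ∃ N, ∀ n, N ≤ n → f (n + p) = f n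

end InfWord

/-!
Write `C` and `P` for the factor and palindromic complexities of `w`. Both equivalences follow from
the identity `P(n) + P(n+1) + C(n) = C(n+1) + 2`, valid for every `n` when `w` is recurrent and rich
(`Rich.palComplexity_add_palComplexity_succ`). By it, `P(n) + P(n+1) = 2` means `C(n+1) = C(n)`,
which for a recurrent word is pure periodicity, by the argument of Morse and Hedlund; and
`P(n+2) = P(n)` for large `n` means that `P(n) + P(n+1)`, hence `C(n+1) - C(n)`, is eventually
constant.

The identity counts factors up to reversal by the positions of their first occurrences. Richness
gives each block of `w` a palindromic suffix that occurs only once in it, and therefore each block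
running between two successive visits to a pair `{v, v.reverse}` is a palindrome
(`Rich.isPalindrome_between`). So, when `w` is read as a walk on the classes of its factors of
length `n`, the walk returns to a class along the edge by which it left. Hence a non-palindromic
factor of length `n + 1` is new up to reversal exactly when the factor of length `n` at its
end is new up to reversal (`Rich.new_block_succ_iff`): the graph of classes is a tree, once loops
are removed. Its vertices number one more than its edges. As `w` is closed under
reversal (`Rich.isFactor_reverse`), there are `(C(n) + P(n)) / 2` vertices and
`(C(n+1) - P(n+1)) / 2` edges.
-/

namespace InfWord

variable {A : Type*} {w : ℕ → A}

/-! ### Blocks, letter by letter -/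

@[simp] theorem length_block (w : ℕ → A) (i n : ℕ) : (block w i n).length = n := by
  simp [block]

@[simp] theorem getElem_block (w : ℕ → A) (i n k : ℕ) (h : k < (block w i n).length) :
    (block w i n)[k] = w (i + k) := by
  simp [block]

theorem block_eq_block_iff {i j n : ℕ} :
    block w i n = block w j n ↔ ∀ k < n, w (i + k) = w (j + k) := by
  constructor
  · intro h k hk
    have := List.getElem_of_eq h (i := k) (by simpa using hk)
    simpa using this
  · intro h
    refine List.ext_getElem (by simp) fun k h₁ h₂ => ?_
    simpa using h k (by simpa using h₁)

theorem block_eq_reverse_block_iff {i j n : ℕ} :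
    block w i n = (block w j n).reverse ↔ ∀ k < n, w (i + k) = w (j + (n - 1 - k)) := by
  constructor
  · intro h k hk
    have := List.getElem_of_eq h (i := k) (by simpa using hk)
    simpa using this
  · intro h
    refine List.ext_getElem (by simp) fun k h₁ h₂ => ?_
    simpa using h k (by simpa using h₁)

theorem isPalindrome_block_iff {i n : ℕ} :
    IsPalindrome (block w i n) ↔ ∀ k < n, w (i + k) = w (i + (n - 1 - k)) := by
  rw [← block_eq_reverse_block_iff, IsPalindrome, eq_comm]

theorem block_add (w : ℕ → A) (i m n : ℕ) :
    block w i (m + n) = block w i m ++ block w (i + m) n := by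
  refine List.ext_getElem (by simp) fun k h₁ h₂ => ?_
  simp only [List.getElem_append, getElem_block, length_block]
  split_ifs with h
  · rfl
  · congr 1
    omega

theorem isFactor_block (w : ℕ → A) (i n : ℕ) : IsFactor w (block w i n) :=
  ⟨i, by simp [OccursIn]⟩

theorem setOf_isFactor_length_eq (w : ℕ → A) (n : ℕ) :
    {u : List A | IsFactor w u ∧ u.length = n} = Set.range fun i => block w i n := by
  ext u
  constructor
  · rintro ⟨⟨i, hi⟩, rfl⟩
    exact ⟨i, hi⟩
  · rintro ⟨i, rfl⟩
    exact ⟨isFactor_block w i n, length_block w i n⟩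

theorem occursInFinite_block_iff {i m l : ℕ} {u : List A} :
    OccursInFinite (block w i m) u l ↔
      l + u.length ≤ m ∧ block w (i + l) u.length = u := by
  constructor
  · rintro ⟨s, t, h, rfl⟩
    have hm : m = s.length + u.length + t.length := by
      simpa [add_assoc] using congrArg List.length h
    subst hm
    rw [block_add, block_add] at h
    have h₁ := (List.append_inj h (by simp)).1
    exact ⟨by omega, (List.append_inj h₁ (by simp)).2⟩
  · rintro ⟨hl, hu⟩
    obtain ⟨d, rfl⟩ := Nat.exists_eq_add_of_le hl
    refine ⟨block w i l, block w (i + (l + u.length)) d, ?_, by simp⟩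
    rw [block_add, block_add, hu]

/-! ### Palindromes in rich words -/

/-- A block of length `m` of a rich word ends with a palindrome that occurs nowhere else in that
block: the longest palindromic suffix. If it occurred earlier, the complete return
from its last earlier occurrence would be a longer palindromic suffix. -/
theorem Rich.exists_unioccurrent_palindromic_suffix (hw : Rich w) (i m : ℕ) :
    ∃ k ≤ m, IsPalindrome (block w (i + (m - k)) k) ∧
      ∀ l < m - k, block w (i + l) k ≠ block w (i + (m - k)) k := by
  classical
  let Q : ℕ → Prop := fun k => IsPalindrome (block w (i + (m - k)) k)
  have hQ0 : Q 0 := by simp [Q, IsPalindrome, block]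
  obtain ⟨k, hk⟩ : ∃ k, k = Nat.findGreatest Q m := ⟨_, rfl⟩
  have hkm : k ≤ m := hk ▸ Nat.findGreatest_le m
  have hkQ : Q k := hk ▸ Nat.findGreatest_spec (P := Q) (Nat.zero_le m) hQ0
  have hmax : ∀ k', k < k' → k' ≤ m → ¬ Q k' := fun k' h h' =>
    Nat.findGreatest_is_greatest (hk ▸ h) h'
  refine ⟨k, hkm, hkQ, ?_⟩
  by_contra! hex
  obtain ⟨l₀, hl₀, hocc₀⟩ := hex
  let R : ℕ → Prop := fun l => l < m - k ∧ block w (i + l) k = block w (i + (m - k)) k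
  obtain ⟨l, hl⟩ : ∃ l, l = Nat.findGreatest R (m - k) := ⟨_, rfl⟩
  obtain ⟨hlm, hocc⟩ : R l :=
    hl ▸ Nat.findGreatest_spec (P := R) hl₀.le ⟨hl₀, hocc₀⟩
  have hlast : ∀ l', l < l' → l' < m - k → block w (i + l') k ≠ block w (i + (m - k)) k :=
    fun l' h h' e => Nat.findGreatest_is_greatest (P := R) (hl ▸ h) h'.le ⟨h', e⟩
  have hret : IsCompleteReturn w (block w (i + (m - k)) k) (block w (i + l) (m - l)) := by
    refine ⟨isFactor_block _ _ _, ?_, ?_, ?_⟩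
    · refine ⟨block w (i + l + k) (m - l - k), ?_⟩
      rw [← hocc, ← block_add]
      congr 1
      omega
    · refine ⟨block w (i + l) (m - l - k), ?_⟩
      have h₁ : i + (m - k) = i + l + (m - l - k) := by omega
      rw [h₁, ← block_add]
      congr 1
      omega
    · have hset : {j | OccursInFinite (block w (i + l) (m - l)) (block w (i + (m - k)) k) j} =
          {0, m - l - k} := by
        ext j
        simp only [Set.mem_ofPred_eq, occursInFinite_block_iff, length_block,
          Set.mem_insert_iff, Set.mem_singleton_iff]
        constructor
        · rintro ⟨hj, he⟩
          by_contra! hne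
          refine hlast (l + j) (by omega) (by omega) ?_
          rw [← add_assoc]
          exact he
        · rintro (rfl | rfl)
          · exact ⟨by omega, hocc⟩
          · refine ⟨by omega, ?_⟩
            congr 1
            omega
      rw [hset]
      exact Set.ncard_pair (by omega)
  refine hmax (m - l) (by omega) (by omega) ?_
  have h₁ : m - (m - l) = l := by omega
  have := hw _ (isFactor_block _ _ _) hkQ _ hret
  simpa only [Q, h₁] using this

/-- In a rich word, the block running between two successive visits to the pair `{v, v.reverse}`
is a palindrome, whether or not `v` is one. Its unioccurrent palindromic suffix cannot be as
short as `v`, since it would occur in the first visit too; so it starts with `v.reverse`,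
which is only possible at the first visit. -/
theorem Rich.isPalindrome_between (hw : Rich w) {i j n : ℕ} (hji : j < i)
    (hj : block w j n = block w i n ∨ block w j n = (block w i n).reverse)
    (hbetween : ∀ l, j < l → l < i → block w l n ≠ (block w i n).reverse) :
    IsPalindrome (block w j (i - j + n)) := by
  obtain ⟨k, hkm, hpal, huni⟩ := hw.exists_unioccurrent_palindromic_suffix j (i - j + n)
  rw [isPalindrome_block_iff] at hpal
  rcases le_or_gt k n with hkn | hkn
  · exfalso
    rcases hj with hj | hj
    · rw [block_eq_block_iff] at hj
      refine huni (n - k) (by omega) (block_eq_block_iff.2 fun t ht => ?_)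
      have := hj (n - k + t) (by omega)
      rw [add_assoc, this]
      congr 1
      omega
    · rw [block_eq_reverse_block_iff] at hj
      refine huni 0 (by omega) (block_eq_block_iff.2 fun t ht => ?_)
      rw [hpal t ht, add_zero, hj t (by omega)]
      congr 1
      omega
  · have hrev : block w (j + (i - j + n - k)) n = (block w i n).reverse := by
      rw [block_eq_reverse_block_iff]
      intro t ht
      rw [hpal t (by omega)]
      congr 1
      omega
    rcases Nat.eq_zero_or_pos (i - j + n - k) with h0 | h0
    · have hk : k = i - j + n := by omega
      subst hk
      simpa [isPalindrome_block_iff] using hpal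
    · exact absurd hrev (hbetween _ (by omega) (by omega))

/-- A recurrent rich word is closed under reversal: if `u.reverse` did not occur, the block
between two successive occurrences of `u` would be a palindrome ending with `u.reverse`. -/
theorem Rich.isFactor_reverse (hw : Rich w) (hrec : Recurrent w) {u : List A}
    (hu : IsFactor w u) : IsFactor w u.reverse := by
  classical
  by_contra hno
  obtain ⟨j, hj⟩ := hu
  obtain ⟨n, hn⟩ : ∃ n, n = u.length := ⟨_, rfl⟩
  have hnot : ∀ l, block w l n ≠ u.reverse := fun l h =>
    hno ⟨l, by rw [OccursIn, List.length_reverse, ← hn, h]⟩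
  obtain ⟨i, hi, hji⟩ := (hrec u ⟨j, hj⟩).exists_gt j
  have hi' : block w i n = u := by rw [hn]; exact hi
  have hj' : block w j n = u := by rw [hn]; exact hj
  have hpal := hw.isPalindrome_between (n := n) hji (.inl (hj'.trans hi'.symm))
    fun l _ _ => hi'.symm ▸ hnot l
  rw [isPalindrome_block_iff] at hpal
  refine hnot i ?_
  rw [← hj', block_eq_reverse_block_iff]
  intro t ht
  have := hpal (i - j + t) (by omega)
  convert this using 2 <;> omega

/-! ### Classes of words up to reversal -/

/-- The unordered pair of a word and its reversal: its class up to reversal. -/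
def revClass (u : List A) : Sym2 (List A) := s(u, u.reverse)

theorem revClass_eq_iff {u v : List A} :
    revClass u = revClass v ↔ u = v ∨ u = v.reverse := by
  simp only [revClass, Sym2.eq_iff]
  constructor
  · rintro (h | h)
    · exact .inl h.1
    · exact .inr h.1
  · rintro (rfl | rfl) <;> simp

/-- In a finite reversal-closed set, a class up to reversal has one element if it
is that of a palindrome and two elements otherwise. -/
theorem ncard_add_ncard_isPalindrome {S : Set (List A)} (hS : S.Finite)
    (hrev : ∀ u ∈ S, u.reverse ∈ S) :
    S.ncard + {u ∈ S | IsPalindrome u}.ncard = 2 * (revClass '' S).ncard := by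
  classical
  lift S to Finset (List A) using hS
  have h₁ : {u ∈ (S : Set (List A)) | IsPalindrome u} =
      (S.filter IsPalindrome : Finset (List A)) := by ext; simp
  rw [h₁, ← Finset.coe_image, Set.ncard_coe_finset, Set.ncard_coe_finset, Set.ncard_coe_finset,
    Finset.card_eq_sum_card_image revClass S,
    Finset.card_eq_sum_card_fiberwise (f := revClass) (s := S.filter IsPalindrome)
      (t := S.image revClass), ← Finset.sum_add_distrib, mul_comm,
    Finset.sum_const_nat (m := 2)]
  · intro c hc
    obtain ⟨u, hu, rfl⟩ := Finset.mem_image.1 hc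
    have hfib : S.filter (fun v => revClass v = revClass u) = {u, u.reverse} := by
      ext v
      simp only [Finset.mem_filter, revClass_eq_iff, Finset.mem_insert, Finset.mem_singleton]
      constructor
      · exact fun h => h.2
      · rintro (rfl | rfl)
        · exact ⟨hu, .inl rfl⟩
        · exact ⟨hrev _ hu, .inr rfl⟩
    rw [Finset.filter_comm, hfib, Finset.filter_insert, Finset.filter_singleton]
    by_cases hp : u.reverse = u
    · simp [IsPalindrome, hp]
    · simp [IsPalindrome, hp, Ne.symm hp, Finset.card_pair (Ne.symm hp)]
  · intro u hu
    exact Finset.mem_coe.2 (Finset.mem_image_of_mem _ (Finset.mem_filter.1 hu).1)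

/-- The values of a sequence that satisfy `p` are counted by the indices of their first
occurrences. -/
theorem ncard_image_eq_ncard_first {X : Type*} (a : ℕ → X) (p : X → Prop) :
    (a '' {i | p (a i)}).ncard = {i | p (a i) ∧ ∀ j < i, a j ≠ a i}.ncard := by
  classical
  have hinj : Set.InjOn a {i | p (a i) ∧ ∀ j < i, a j ≠ a i} := by
    intro i hi j hj h
    rcases lt_trichotomy i j with hij | hij | hij
    · exact absurd h (hj.2 i hij)
    · exact hij
    · exact absurd h.symm (hi.2 j hij)
  rw [← hinj.ncard_image]
  congr 1
  ext x
  constructor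
  · rintro ⟨i, hi, rfl⟩
    have hex : ∃ j, a j = a i := ⟨i, rfl⟩
    have hs := Nat.find_spec hex
    refine ⟨Nat.find hex, ⟨by rw [hs]; exact hi, fun j hj h => ?_⟩, hs⟩
    exact Nat.find_min hex hj (h.trans hs)
  · rintro ⟨i, hi, rfl⟩
    exact ⟨i, hi.1, rfl⟩

/-! ### The complexity identity -/

theorem finite_setOf_isFactor_length_eq [Finite A] (w : ℕ → A) (n : ℕ) :
    {u : List A | IsFactor w u ∧ u.length = n}.Finite :=
  (List.finite_length_eq A n).subset fun _ h => h.2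

/-- A block of length `n` at `i + 1` is new up to reversal exactly when the block of length
`n + 1` at `i`, which ends with it, is not a palindrome and is new up to reversal. -/
theorem Rich.new_block_succ_iff (hw : Rich w) (n i : ℕ) :
    (∀ j < i + 1, revClass (block w j n) ≠ revClass (block w (i + 1) n)) ↔
      ¬ IsPalindrome (block w i (n + 1)) ∧
        ∀ j < i, revClass (block w j (n + 1)) ≠ revClass (block w i (n + 1)) := by
  classical
  constructor
  · intro hnew
    simp only [ne_eq, revClass_eq_iff, not_or] at hnew
    refine ⟨fun hpal => (hnew i (by omega)).2 ?_, fun j hj h => ?_⟩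
    · rw [isPalindrome_block_iff] at hpal
      rw [block_eq_reverse_block_iff]
      intro t ht
      rw [hpal t (by omega)]
      congr 1
      omega
    · rcases revClass_eq_iff.1 h with h | h
      · rw [block_eq_block_iff] at h
        refine (hnew (j + 1) (by omega)).1 (block_eq_block_iff.2 fun t ht => ?_)
        have := h (t + 1) (by omega)
        convert this using 2 <;> omega
      · rw [block_eq_reverse_block_iff] at h
        refine (hnew j (by omega)).2 (block_eq_reverse_block_iff.2 fun t ht => ?_)
        rw [h t (by omega)]
        congr 1
        omega
  · rintro ⟨hpal, hnew⟩ j₀ hj₀ h₀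
    -- Take the last earlier visit `j` to the class of the block at `i + 1`. The palindrome
    -- running from there to `i + 1` maps its last `n + 1` letters to its first `n + 1` letters.
    let R : ℕ → Prop := fun l => revClass (block w l n) = revClass (block w (i + 1) n)
    obtain ⟨j, hj⟩ : ∃ j, j = Nat.findGreatest R i := ⟨_, rfl⟩
    have hji : j ≤ i := hj ▸ Nat.findGreatest_le i
    have hR : R j := hj ▸ Nat.findGreatest_spec (P := R) (Nat.le_of_lt_succ hj₀) h₀
    have hlast : ∀ l, j < l → l < i + 1 → block w l n ≠ (block w (i + 1) n).reverse :=
      fun l h h' e => Nat.findGreatest_is_greatest (P := R) (hj ▸ h) (Nat.le_of_lt_succ h')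
        (revClass_eq_iff.2 (.inr e))
    have hr := hw.isPalindrome_between (Nat.lt_succ_of_le hji) (revClass_eq_iff.1 hR) hlast
    rw [isPalindrome_block_iff] at hr
    have hrev : block w j (n + 1) = (block w i (n + 1)).reverse := by
      rw [block_eq_reverse_block_iff]
      intro t ht
      rw [hr t (by omega)]
      congr 1
      omega
    rcases hji.lt_or_eq with hlt | rfl
    · exact hnew j hlt (revClass_eq_iff.2 (.inr hrev))
    · exact hpal hrev.symm

theorem isPalindrome_reverse {u : List A} : IsPalindrome u.reverse ↔ IsPalindrome u := by
  simp [IsPalindrome, eq_comm]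

theorem palComplexity_eq (w : ℕ → A) (n : ℕ) :
    palComplexity w n =
      {u ∈ {u : List A | IsFactor w u ∧ u.length = n} | IsPalindrome u}.ncard := by
  rw [palComplexity]
  congr 1
  ext u
  simp only [Set.mem_ofPred_eq]
  tauto

/-- Both sides count classes up to reversal twice: `C(n) + P(n)` is twice the number of classes of
factors of length `n`, and `C(n+1) - P(n+1)` is twice the number of classes of non-palindromic
factors of length `n + 1`, which correspond to all classes of length `n` but the first. -/
theorem Rich.palComplexity_add_palComplexity_succ [Finite A] (hw : Rich w) (hrec : Recurrent w)
    (n : ℕ) :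
    palComplexity w n + palComplexity w (n + 1) + factorComplexity w n =
      factorComplexity w (n + 1) + 2 := by
  classical
  have hcl : ∀ m, ∀ u ∈ {u : List A | IsFactor w u ∧ u.length = m},
      u.reverse ∈ {u : List A | IsFactor w u ∧ u.length = m} := fun m u hu =>
    ⟨hw.isFactor_reverse hrec hu.1, by rw [List.length_reverse]; exact hu.2⟩
  have hV := ncard_add_ncard_isPalindrome (finite_setOf_isFactor_length_eq w n) (hcl n)
  rw [← palComplexity_eq, ← factorComplexity] at hV
  set N : Set (List A) :=
    {u ∈ {u : List A | IsFactor w u ∧ u.length = n + 1} | ¬ IsPalindrome u} with hN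
  have hfin := finite_setOf_isFactor_length_eq w (n + 1)
  have hE := ncard_add_ncard_isPalindrome (S := N) (hfin.subset fun u hu => hu.1)
    fun u hu => ⟨hcl _ u hu.1, fun h => hu.2 (isPalindrome_reverse.1 h)⟩
  have hempty : {u ∈ N | IsPalindrome u} = ∅ := by
    ext u
    simp only [hN, Set.mem_ofPred_eq, Set.mem_empty_iff_false, iff_false]
    tauto
  rw [hempty, Set.ncard_empty, add_zero] at hE
  have hsplit : palComplexity w (n + 1) + N.ncard = factorComplexity w (n + 1) := by
    rw [palComplexity_eq, factorComplexity, hN]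
    exact Set.ncard_inter_add_ncard_sdiff_eq_ncard _ {u | IsPalindrome u} hfin
  have himV : revClass '' {u : List A | IsFactor w u ∧ u.length = n} =
      (fun i => revClass (block w i n)) '' {_i | True} := by
    rw [setOf_isFactor_length_eq, ← Set.range_comp]
    simp [Function.comp_def]
  -- `IsPalindrome` depends only on the class, so it can be read off the class.
  let p : Sym2 (List A) → Prop := fun c => ∃ u, revClass u = c ∧ ¬ IsPalindrome u
  have hp : ∀ u : List A, p (revClass u) ↔ ¬ IsPalindrome u := by
    intro u
    constructor
    · rintro ⟨v, hv, hv'⟩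
      rcases revClass_eq_iff.1 hv with rfl | rfl
      · exact hv'
      · rwa [isPalindrome_reverse] at hv'
    · exact fun h => ⟨u, rfl, h⟩
  have himE : revClass '' N = (fun i => revClass (block w i (n + 1))) ''
      {i | p (revClass (block w i (n + 1)))} := by
    ext c
    rw [hN, setOf_isFactor_length_eq]
    simp only [hp]
    constructor
    · rintro ⟨_, ⟨⟨i, rfl⟩, hi⟩, rfl⟩
      exact ⟨i, hi, rfl⟩
    · rintro ⟨i, hi, rfl⟩
      exact ⟨_, ⟨⟨i, rfl⟩, hi⟩, rfl⟩
  have hcV := ncard_image_eq_ncard_first (fun i => revClass (block w i n)) (fun _ => True)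
  have hcE := ncard_image_eq_ncard_first (fun i => revClass (block w i (n + 1))) p
  rw [← himV] at hcV
  rw [← himE] at hcE
  simp only [hp] at hcE
  simp only [true_and] at hcV
  set T : Set ℕ := {i | ¬ IsPalindrome (block w i (n + 1)) ∧
    ∀ j < i, revClass (block w j (n + 1)) ≠ revClass (block w i (n + 1))} with hT
  have hnew : {i | ∀ j < i, revClass (block w j n) ≠ revClass (block w i n)} =
      insert 0 (Nat.succ '' T) := by
    ext i
    cases i with
    | zero => simp
    | succ i =>
      rw [Set.mem_ofPred_eq, hw.new_block_succ_iff]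
      simp [hT]
  -- The class of a new block determines its position, so there are finitely many new ones.
  have hTfin : T.Finite := by
    refine Set.Finite.of_finite_image (f := fun i => revClass (block w i (n + 1)))
      ((hfin.image revClass).subset ?_) ?_
    · rintro _ ⟨i, -, rfl⟩
      exact ⟨_, ⟨isFactor_block w i (n + 1), length_block _ _ _⟩, rfl⟩
    · intro i hi j hj h
      rcases lt_trichotomy i j with hij | hij | hij
      · exact absurd h (hj.2 i hij)
      · exact hij
      · exact absurd h.symm (hi.2 j hij)
  rw [hnew, Set.ncard_insert_of_notMem (by simp) (hTfin.image _),
    Set.ncard_image_of_injective _ Nat.succ_injective] at hcV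
  omega

/-! ### Factor complexity and periodicity -/

theorem image_take_factors (w : ℕ → A) (n : ℕ) :
    List.take n '' {u : List A | IsFactor w u ∧ u.length = n + 1} =
      {u : List A | IsFactor w u ∧ u.length = n} := by
  rw [setOf_isFactor_length_eq, setOf_isFactor_length_eq, ← Set.range_comp]
  congr 1
  funext i
  simp [block_add w i n 1]

theorem factorComplexity_le_succ [Finite A] (w : ℕ → A) (n : ℕ) :
    factorComplexity w n ≤ factorComplexity w (n + 1) := by
  rw [factorComplexity, ← image_take_factors]
  exact Set.ncard_image_le (finite_setOf_isFactor_length_eq w (n + 1))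

/-- If `C(n+1) = C(n)`, every block of length `n` determines all letters to its right; by
recurrence the initial block occurs again, and its next position is a period. -/
theorem Recurrent.purelyPeriodic [Finite A] (hrec : Recurrent w) {n : ℕ}
    (hn : factorComplexity w (n + 1) = factorComplexity w n) : PurelyPeriodic w := by
  have hinj : Set.InjOn (List.take n) {u : List A | IsFactor w u ∧ u.length = n + 1} := by
    refine Set.injOn_of_ncard_image_eq ?_ (finite_setOf_isFactor_length_eq w (n + 1))
    rw [image_take_factors]
    exact hn.symm
  have hstep : ∀ i j, block w i n = block w j n → block w i (n + 1) = block w j (n + 1) := by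
    intro i j h
    refine hinj ⟨isFactor_block _ _ _, by simp⟩ ⟨isFactor_block _ _ _, by simp⟩ ?_
    simpa [block_add _ _ n 1] using h
  obtain ⟨p, hp, hp0⟩ := (hrec _ (isFactor_block w 0 n)).exists_gt 0
  rw [Set.mem_ofPred_eq, OccursIn, length_block] at hp
  have hall : ∀ k, block w (p + k) n = block w k n := by
    intro k
    induction k with
    | zero => exact hp
    | succ k ih =>
      have := block_eq_block_iff.1 (hstep _ _ ih)
      refine block_eq_block_iff.2 fun t ht => ?_
      convert this (t + 1) (by omega) using 2 <;> omega
  refine ⟨p, hp0, fun k => ?_⟩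
  rw [add_comm]
  simpa using block_eq_block_iff.1 (hstep _ _ (hall k)) 0 (by omega)

theorem factorComplexity_le_of_periodic {p : ℕ} (hp0 : 0 < p) (hp : Function.Periodic w p)
    (n : ℕ) : factorComplexity w n ≤ p := by
  classical
  have hsub : {u : List A | IsFactor w u ∧ u.length = n} ⊆
      ((Finset.range p).image fun i => block w i n : Finset (List A)) := by
    rw [setOf_isFactor_length_eq]
    rintro _ ⟨i, rfl⟩
    simp only [Finset.coe_image, Set.mem_image, Finset.coe_range, Set.mem_Iio]
    refine ⟨i % p, Nat.mod_lt _ hp0, block_eq_block_iff.2 fun k _ => ?_⟩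
    rw [← hp.map_mod_nat (i % p + k), ← hp.map_mod_nat (i + k), Nat.mod_add_mod]
  calc factorComplexity w n ≤ _ := Set.ncard_le_ncard hsub (Finset.finite_toSet _)
    _ ≤ p := by
      rw [Set.ncard_coe_finset]
      exact Finset.card_image_le.trans (by simp)

theorem PurelyPeriodic.exists_factorComplexity_succ_eq [Finite A] (h : PurelyPeriodic w) :
    ∃ n, factorComplexity w (n + 1) = factorComplexity w n := by
  obtain ⟨p, hp0, hp⟩ := h
  by_contra! hne
  have hmono : StrictMono (factorComplexity w) := strictMono_nat_of_lt_succ fun n =>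
    lt_of_le_of_ne (factorComplexity_le_succ w n) (hne n).symm
  have h₁ := hmono.le_apply (x := p + 1)
  have h₂ := factorComplexity_le_of_periodic hp0 hp (p + 1)
  omega

end InfWord

theorem mainTheorem6 {A : Type*} [Finite A] (w : ℕ → A)
    (hrec : InfWord.Recurrent w) (hrich : InfWord.Rich w) :
    (InfWord.PurelyPeriodic w ↔
      ∃ n : ℕ, InfWord.palComplexity w n + InfWord.palComplexity w (n + 1) = 2) ∧
    (InfWord.EventuallyPeriodicWith (InfWord.palComplexity w) 2 ↔
      ∃ (K : ℕ) (L : ℤ) (N : ℕ), ∀ n : ℕ, N ≤ n →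
        (InfWord.factorComplexity w n : ℤ) = (K : ℤ) * (n : ℤ) + L) := by
  have hid := hrich.palComplexity_add_palComplexity_succ hrec
  refine ⟨⟨fun h => ?_, fun ⟨n, hn⟩ => ?_⟩, ⟨fun ⟨N, hN⟩ => ?_, fun ⟨K, L, N, hN⟩ => ?_⟩⟩
  · obtain ⟨n, hn⟩ := h.exists_factorComplexity_succ_eq
    exact ⟨n, by have := hid n; omega⟩
  · exact hrec.purelyPeriodic (n := n) (by have := hid n; omega)
  · -- From `N` on, `P(n) + P(n+1)` is constant, hence so is `C(n+1) - C(n)`.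
    obtain ⟨K, hK⟩ := Nat.exists_eq_add_of_le (InfWord.factorComplexity_le_succ w N)
    have hdiff : ∀ d, InfWord.factorComplexity w (N + d + 1) =
        InfWord.factorComplexity w (N + d) + K := by
      intro d
      induction d with
      | zero => exact hK
      | succ d ih =>
        have h₁ := hid (N + d)
        have h₂ := hid (N + d + 1)
        have h₃ : InfWord.palComplexity w (N + d + 1 + 1) = InfWord.palComplexity w (N + d) :=
          hN (N + d) (by omega)
        rw [← add_assoc]
        omega
    refine ⟨K, InfWord.factorComplexity w N - K * N, N, fun n hn => ?_⟩
    obtain ⟨d, rfl⟩ := Nat.exists_eq_add_of_le hn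
    induction d with
    | zero => simp
    | succ d ih =>
      have := ih (by omega)
      rw [← add_assoc, hdiff d]
      push_cast at this ⊢
      linarith
  · refine ⟨N, fun n hn => ?_⟩
    have h₁ := hid n
    have h₂ := hid (n + 1)
    have h₃ := hN n hn
    have h₄ := hN (n + 1) (by omega)
    have h₅ := hN (n + 2) (by omega)
    have h₆ : n + 1 + 1 = n + 2 := rfl
    rw [h₆] at h₂
    push_cast at h₄ h₅
    zify at h₁ h₂ ⊢
    linarith
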